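/- Fix $N,m\in\mathbb N$, a real $N\times N$ matrix $A$ all of whose complex eigenvalues $\lambda_1,\dots,\lambda_N$ (listed with algebraic multiplicity) satisfy $|\lambda_i|\ge 1$, and a real $N\times m$ matrix $B$. Consider the linear system $$x_{t+1}=Ax_t+Bu_t+w_t,\qquad t\ge 0,$$ where $(w_t)_{t\ge0}$ is an i.i.d. $\mathbb R^N$-valued noise process, independent of $x_0$, and where the law of $x_0$ is absolutely continuous with respect to Lebesgue measure, with density $p$ and with differential entropy $h(x_0)=-\int p\log_2 p\,dx$ well defined in $[-\infty,\infty]$ and $h(x_0)<\infty$. The system is controlled over a channel with feedback that has a finite input alphabet $\mathcal M$ and a finite output alphabet $\mathcal M'$ and is given by conditional laws $P(q'_t\mid q_{[0,t]},q'_{[0,t-1]})$, $t\ge0$. An admissible (causal) coding and control policy consists of measurable functions $\gamma^e_t$ and functions $\gamma_t$ such that the channel input is $q_t=\gamma^e_t(x_{[0,t]},q'_{[0,t-1]})\in\mathcal M$ and the control is $u_t=\gamma_t(q'_{[0,t]})\in\mathbb R^m$. The channel is assumed to be of Class A, that is: (a) for all $t\ge0$ and $b\in\mathcal M'$, almost surely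 $P(q'_t=b\mid q_{[0,t]},q'_{[0,t-1]},x_0,(w_s)_{s\ge0})=P(q'_t=b\mid q_{[0,t]},q'_{[0,t-1]})$; (b) its capacity with feedback is given by the (existing) finite limit $$C=\lim_{T\to\infty}\ \max_{\{P(q_t\mid q_{[0,t-1]},q'_{[0,t-1]}),\,0\le t\le T-1\}}\ \frac1T\sum_{t=0}^{T-1} I\big(q_{[0,t]};q'_t\mid q'_{[0,t-1]}\big),$$ where $I$ is conditional mutual information in bits (for $t=0$ the term is $I(q_0;q'_0)$). Call the state process asymptotically mean stationary (AMS) if its law $P$ on $(\mathbb R^N)^{\mathbb Z_{\ge0}}$ (with the product Borel $\sigma$-field and the shift $\theta(x_0,x_1,\dots)=(x_1,x_2,\dots)$) admits a probability measure $\bar P$ with $\lim_{n\to\infty}\frac1n\sum_{k=0}^{n-1}P(\theta^{-k}F)=\bar P(F)$ for every measurable set $F$. If, under some admissible coding and control policy, the state process $(x_t)_{t\ge0}$ is AMS, then $$C\ \ge\ \sum_{i=1}^{N}\log_2|\lambda_i| .$$ -/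

import Mathlib

open MeasureTheory ProbabilityTheory Filter Topology

/-! ### Entropy and conditional mutual information of finite random variables (base 2)

`p` is a probability mass function on a finite set `S`, and random variables are functions on `S`. -/

section FiniteInformation

variable {S X Y Z : Type*} [Fintype S] [Fintype X] [Fintype Y] [Fintype Z]

open Classical in
/-- The probability `P(U = e)` under the mass function `p`. -/
noncomputable def pmfProb {E : Type*} (p : S → ℝ) (U : S → E) (e : E) : ℝ :=
  ∑ s with U s = e, p s

/-- Conditional entropy `H(U | V) = - ∑ P(U = a, V = b) log₂ P(U = a | V = b)`. -/
noncomputable def condEntropy (p : S → ℝ) (U : S → X) (V : S → Y) : ℝ :=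
  -∑ a : X, ∑ b : Y, pmfProb p (fun s => (U s, V s)) (a, b) *
    Real.logb 2 (pmfProb p (fun s => (U s, V s)) (a, b) / pmfProb p V b)

/-- Conditional mutual information `I(U ; V | W) = H(U | W) - H(U | V, W)`. -/
noncomputable def condMutualInfo (p : S → ℝ) (U : S → X) (V : S → Y) (W : S → Z) : ℝ :=
  condEntropy p U W - condEntropy p U (fun s => (V s, W s))

end FiniteInformation

/-! ### Channels with feedback, directed information and capacity -/

/-- A finite-alphabet channel, with memory: the law of the output `q'_t` on `M'` given the inputs
`q_0, …, q_t` and the past outputs `q'_0, …, q'_{t-1}`. -/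
abbrev Channel (M M' : Type*) [Fintype M'] : Type _ :=
  (t : ℕ) → (Fin (t + 1) → M) → (Fin t → M') → stdSimplex ℝ M'

/-- A (randomized) channel-input policy with feedback: the law of `q_t` given
`q_0, …, q_{t-1}` and `q'_0, …, q'_{t-1}`. -/
abbrev InputPolicy (M M' : Type*) [Fintype M] : Type _ :=
  (t : ℕ) → (Fin t → M) → (Fin t → M') → stdSimplex ℝ M

section Capacity

variable {M M' : Type*} [Fintype M] [Fintype M']

/-- The joint mass function of `(q_{[0,T-1]}, q'_{[0,T-1]})` when the input policy `P` is used over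
the channel `Q`. -/
noncomputable def jointPMF (P : InputPolicy M M') (Q : Channel M M') (T : ℕ)
    (z : (Fin T → M) × (Fin T → M')) : ℝ :=
  ∏ t : Fin T,
    (P t (Fin.take t t.isLt.le z.1) (Fin.take t t.isLt.le z.2)).1 (z.1 t) *
      (Q t (Fin.take (t + 1) t.isLt z.1) (Fin.take t t.isLt.le z.2)).1 (z.2 t)

/-- The directed information
`I(q_{[0,T-1]} → q'_{[0,T-1]}) = ∑_{t < T} I(q'_t ; q_{[0,t]} | q'_{[0,t-1]})`
(in the term `t = 0` the conditioning is on the empty tuple, which is no conditioning). -/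
noncomputable def directedInfo (P : InputPolicy M M') (Q : Channel M M') (T : ℕ) : ℝ :=
  ∑ t : Fin T,
    condMutualInfo (jointPMF P Q T)
      (fun z => z.2 t)
      (fun z => Fin.take (t + 1) t.isLt z.1)
      (fun z => Fin.take t t.isLt.le z.2)

/-- `C` is the feedback capacity of the channel `Q`, in bits per channel use:
`C = lim_{T → ∞} max_P (1 / T) I(q_{[0,T-1]} → q'_{[0,T-1]})`, the limit being part of the claim.
(The maximum always exists: the policies form a compact space.) -/
def HasFeedbackCapacity (Q : Channel M M') (C : ℝ) : Prop :=
  ∃ R : ℕ → ℝ,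
    (∀ T : ℕ, IsGreatest (Set.range fun P : InputPolicy M M' => (1 / (T : ℝ)) * directedInfo P Q T)
      (R T)) ∧
    Tendsto R atTop (𝓝 C)

end Capacity

/-! ### Differential entropy -/

section DiffEntropy

variable {N : ℕ}

/-- The density of `μ` with respect to Lebesgue measure. -/
noncomputable def lebDensity (μ : Measure (Fin N → ℝ)) (x : Fin N → ℝ) : ℝ :=
  (μ.rnDeriv volume x).toReal

/-- The integral of the positive part of `-p log₂ p`, where `p` is the density of `μ`. -/
noncomputable def diffEntropyPos (μ : Measure (Fin N → ℝ)) : ENNReal :=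
  ∫⁻ x, ENNReal.ofReal (-(lebDensity μ x * Real.logb 2 (lebDensity μ x)))

/-- The integral of the negative part of `-p log₂ p`, where `p` is the density of `μ`. -/
noncomputable def diffEntropyNeg (μ : Measure (Fin N → ℝ)) : ENNReal :=
  ∫⁻ x, ENNReal.ofReal (lebDensity μ x * Real.logb 2 (lebDensity μ x))

/-- The differential entropy of `μ` is defined: `μ` is absolutely continuous and the integral of
`-p log₂ p` exists in `[-∞, ∞]`. -/
def HasDiffEntropy (μ : Measure (Fin N → ℝ)) : Prop :=
  μ ≪ volume ∧ (diffEntropyPos μ ≠ ⊤ ∨ diffEntropyNeg μ ≠ ⊤)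

/-- The differential entropy `h = -∫ p log₂ p`, in `[-∞, ∞]` (meaningful under `HasDiffEntropy`). -/
noncomputable def diffEntropy (μ : Measure (Fin N → ℝ)) : EReal :=
  (diffEntropyPos μ : EReal) - (diffEntropyNeg μ : EReal)

end DiffEntropy

/-! ### Asymptotic mean stationarity -/

/-- The shift `(x_0, x_1, …) ↦ (x_1, x_2, …)`. -/
def seqShift {X : Type*} (z : ℕ → X) : ℕ → X := fun n => z (n + 1)

/-- A process measure `P` on the one-sided sequence space is asymptotically mean stationary. -/
def IsAMS {X : Type*} [MeasurableSpace X] (P : Measure (ℕ → X)) : Prop :=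
  ∃ Pbar : Measure (ℕ → X), IsProbabilityMeasure Pbar ∧
    ∀ F : Set (ℕ → X), MeasurableSet F →
      Tendsto (fun n : ℕ => (1 / (n : ℝ)) * ∑ k ∈ Finset.range n, P.real (seqShift^[k] ⁻¹' F))
        atTop (𝓝 (Pbar.real F))

/-! ### The controlled system -/

/-- The history `y_0, …, y_{n-1}` of a process. -/
def hist {Ω S : Type*} (y : ℕ → Ω → S) (n : ℕ) (ω : Ω) : Fin n → S := fun i => y i ω

/-- An admissible (causal) coding and control policy: measurable encoders
`q_t = γᵉ_t(x_{[0,t]}, q'_{[0,t-1]})` and controllers `u_t = γ_t(q'_{[0,t]})`. -/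
structure AdmissiblePolicy (N m : ℕ) (M M' : Type*) [MeasurableSpace M] [MeasurableSpace M'] where
  enc : (t : ℕ) → (Fin (t + 1) → Fin N → ℝ) → (Fin t → M') → M
  measurable_enc : ∀ t, Measurable
    (fun z : (Fin (t + 1) → Fin N → ℝ) × (Fin t → M') => enc t z.1 z.2)
  ctrl : (t : ℕ) → (Fin (t + 1) → M') → (Fin m → ℝ)

section ClosedLoop

open scoped Matrix

variable {Ω M M' : Type*} [MeasurableSpace M] [MeasurableSpace M']

/-- The information `σ(q_{[0,t]}, q'_{[0,t-1]})`. -/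
abbrev channelInfo (q : ℕ → Ω → M) (q' : ℕ → Ω → M') (t : ℕ) : MeasurableSpace Ω :=
  MeasurableSpace.comap (fun ω => (hist q (t + 1) ω, hist q' t ω)) inferInstance

/-- The information `σ(q_{[0,t]}, q'_{[0,t-1]}, x_0, w_s : s ≥ 0)`. -/
abbrev channelSourceInfo {N : ℕ} (q : ℕ → Ω → M) (q' : ℕ → Ω → M')
    (x₀ : Ω → Fin N → ℝ) (w : ℕ → Ω → Fin N → ℝ) (t : ℕ) : MeasurableSpace Ω :=
  MeasurableSpace.comap
    (fun ω => (hist q (t + 1) ω, hist q' t ω, x₀ ω, fun s : ℕ => w s ω)) inferInstance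

/-- On the probability space `(Ω, μ)`, the processes `x, w, u, q, q'` are those of the linear system
`x_{t+1} = A x_t + B u_t + w_t`, with i.i.d. noise `w_t ∼ ν` independent of `x_0`, controlled over
the channel `Q` with feedback under the admissible policy `pol`. The last field is the Markov chain
condition `q'_t ↔ (q_{[0,t]}, q'_{[0,t-1]}) ↔ (x_0, w_s : s ≥ 0)` of Class A channels. -/
structure IsClosedLoop [MeasurableSpace Ω] [Fintype M'] {N m : ℕ}
    (μ : Measure Ω) (A : Matrix (Fin N) (Fin N) ℝ) (B : Matrix (Fin N) (Fin m) ℝ)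
    (ν : Measure (Fin N → ℝ)) (Q : Channel M M') (pol : AdmissiblePolicy N m M M')
    (x w : ℕ → Ω → Fin N → ℝ) (u : ℕ → Ω → Fin m → ℝ) (q : ℕ → Ω → M) (q' : ℕ → Ω → M') :
    Prop where
  measurable_init : Measurable (x 0)
  measurable_noise : ∀ t, Measurable (w t)
  measurable_output : ∀ t, Measurable (q' t)
  noise_law : ∀ t, μ.map (w t) = ν
  noise_indep : iIndepFun w μ
  init_indep : IndepFun (x 0) (fun ω => fun t : ℕ => w t ω) μ
  dynamics : ∀ t ω, x (t + 1) ω = A *ᵥ x t ω + B *ᵥ u t ω + w t ω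
  encoder : ∀ t ω, q t ω = pol.enc t (hist x (t + 1) ω) (hist q' t ω)
  controller : ∀ t ω, u t ω = pol.ctrl t (hist q' (t + 1) ω)
  channel_law : ∀ t b, μ⟦q' t ⁻¹' {b} | channelInfo q q' t⟧ =ᵐ[μ]
    fun ω => (Q t (hist q (t + 1) ω) (hist q' t ω)).1 b
  classA_markov : ∀ t b, μ⟦q' t ⁻¹' {b} | channelSourceInfo q q' (x 0) w t⟧ =ᵐ[μ]
    μ⟦q' t ⁻¹' {b} | channelInfo q q' t⟧

end ClosedLoop

/-!
Fix the outputs up to time `T`. The controls are then fixed, and `x_T = A ^ T x_0 + y` with `y`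
independent of `x_0`; since `A ^ T` expands volume by `|det A| ^ T`, the event that the density of
`x_0` at `x_0` is at most `L` while `x_T` lies in a compact set `K` has probability at most
`L vol(K) |det A| ^ (-T)`. An AMS state nevertheless visits a suitable `K` with probability close to
one for infinitely many `T`. The closed loop can only beat the fixed-output bound through the
dependence of the outputs on the inputs, whose likelihood ratio has the directed information as mean
logarithm: a change of measure, using `log y ≤ y - 1`, gives
`(1 - ε) T log₂ |det A| - O(1) ≤ I(q_{[0,T-1]} → q'_{[0,T-1]}) ≤ T C + o(T)`.
-/

section FiniteRange

variable {Ω S E : Type*} [MeasurableSpace Ω] {μ : Measure Ω}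

/-- The probability under `μ` of the value that `Y` takes at `ω`. The entropy of a random variable
of finite range is `-𝔼[log₂ (realizedProb μ Y)]`. -/
noncomputable def realizedProb (μ : Measure Ω) (Y : Ω → S) (ω : Ω) : ℝ :=
  μ.real (Y ⁻¹' {Y ω})

lemma ae_realizedProb_pos [IsFiniteMeasure μ] [Countable S] (Y : Ω → S) :
    ∀ᵐ ω ∂μ, 0 < realizedProb μ Y ω := by
  have hnull : ∀ᵐ ω ∂μ, ∀ y, μ (Y ⁻¹' {y}) = 0 → Y ω ≠ y := ae_all_iff.2 fun y => by
    by_cases h0 : μ (Y ⁻¹' {y}) = 0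
    · filter_upwards [measure_eq_zero_iff_ae_notMem.1 h0] with ω hω _ using hω
    · exact ae_of_all _ fun _ h => absurd h h0
  filter_upwards [hnull] with ω hω
  exact ENNReal.toReal_pos (fun h0 => hω _ h0 rfl) (measure_ne_top μ _)

variable [MeasurableSpace S] [MeasurableSingletonClass S] {Y : Ω → S}

lemma integrable_comp_of_finite [Finite S] [IsFiniteMeasure μ] (hY : Measurable Y) (g : S → ℝ) :
    Integrable (fun ω => g (Y ω)) μ :=
  Integrable.of_finite.comp_measurable hY

variable [Fintype S]

lemma integral_comp_eq_sum [IsFiniteMeasure μ] (hY : Measurable Y) (g : S → ℝ) :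
    ∫ ω, g (Y ω) ∂μ = ∑ y, μ.real (Y ⁻¹' {y}) * g y := by
  rw [← integral_map hY.aemeasurable Integrable.of_finite.aestronglyMeasurable,
    integral_fintype Integrable.of_finite]
  simp only [map_measureReal_apply hY (measurableSet_singleton _), smul_eq_mul]

lemma integral_eq_sum_setIntegral_fiber (hY : Measurable Y) {f : Ω → ℝ} (hf : Integrable f μ) :
    ∫ ω, f ω ∂μ = ∑ y, ∫ ω in Y ⁻¹' {y}, f ω ∂μ := by
  rw [← integral_iUnion_fintype (fun y => hY (measurableSet_singleton y))
    (fun y z hyz => (Set.disjoint_singleton.2 hyz).preimage Y) fun y => hf.integrableOn,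
    ← Set.preimage_iUnion, Set.iUnion_of_singleton, Set.preimage_univ, setIntegral_univ]

lemma exists_stdSimplex_measureReal_inter_eq_mul [IsProbabilityMeasure μ] (hY : Measurable Y)
    (G : Set Ω) : ∃ p : stdSimplex ℝ S, ∀ y, μ.real (Y ⁻¹' {y} ∩ G) = p.1 y * μ.real G := by
  classical
  by_cases hG : μ.real G = 0
  · obtain ⟨ω⟩ := μ.nonempty_of_neZero
    refine ⟨⟨_, single_mem_stdSimplex ℝ (Y ω)⟩, fun y => ?_⟩
    rw [hG, mul_zero, measureReal_mono_null Set.inter_subset_right hG]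
  · have hsum : ∑ y, μ.real (Y ⁻¹' {y} ∩ G) = μ.real G := by
      have hfibres := sum_measureReal_preimage_singleton (μ := μ.restrict G) (f := Y) Finset.univ
        fun y _ => hY (measurableSet_singleton y)
      simpa only [measureReal_restrict_apply (hY (measurableSet_singleton _)), Finset.coe_univ,
        Set.preimage_univ, measureReal_restrict_apply MeasurableSet.univ, Set.univ_inter]
        using hfibres
    refine ⟨⟨fun y => μ.real (Y ⁻¹' {y} ∩ G) / μ.real G, fun y => by positivity, ?_⟩,
      fun y => (div_mul_cancel₀ _ hG).symm⟩
    rw [← Finset.sum_div, hsum, div_self hG]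

lemma pmfProb_measureReal_preimage [IsFiniteMeasure μ] (hY : Measurable Y) (U : S → E) (e : E) :
    pmfProb (fun s => μ.real (Y ⁻¹' {s})) U e = μ.real ((fun ω => U (Y ω)) ⁻¹' {e}) := by
  classical
  rw [pmfProb, sum_measureReal_preimage_singleton _ fun y _ => hY (measurableSet_singleton y)]
  congr 1
  ext ω
  simp

section

variable {U V W : Type*} [Fintype U] [Fintype V] [Fintype W] [IsFiniteMeasure μ]

lemma condEntropy_measureReal_preimage (hY : Measurable Y) (f : S → U) (g : S → V) :
    condEntropy (fun s => μ.real (Y ⁻¹' {s})) f g =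
      -∫ ω, Real.logb 2 (realizedProb μ (fun ω => (f (Y ω), g (Y ω))) ω /
        realizedProb μ (fun ω => g (Y ω)) ω) ∂μ := by
  let : MeasurableSpace (U × V) := ⊤
  have hfg : Measurable fun ω => (f (Y ω), g (Y ω)) :=
    (measurable_of_finite fun s => (f s, g s)).comp hY
  have hint := integral_comp_eq_sum (μ := μ) hfg fun e =>
    Real.logb 2 (μ.real ((fun ω => (f (Y ω), g (Y ω))) ⁻¹' {e}) /
      μ.real ((fun ω => g (Y ω)) ⁻¹' {e.2}))
  simp only [condEntropy, pmfProb_measureReal_preimage hY]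
  rw [← Fintype.sum_prod_type', ← hint]
  rfl

lemma condMutualInfo_measureReal_preimage (hY : Measurable Y) (f : S → U) (g : S → V) (h : S → W) :
    condMutualInfo (fun s => μ.real (Y ⁻¹' {s})) f g h =
      ∫ ω, (Real.logb 2 (realizedProb μ (fun ω => (f (Y ω), g (Y ω), h (Y ω))) ω /
          realizedProb μ (fun ω => (g (Y ω), h (Y ω))) ω) -
        Real.logb 2 (realizedProb μ (fun ω => (f (Y ω), h (Y ω))) ω /
          realizedProb μ (fun ω => h (Y ω)) ω)) ∂μ := by
  rw [condMutualInfo, condEntropy_measureReal_preimage hY, condEntropy_measureReal_preimage hY f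
    fun s => (g s, h s), integral_sub, neg_sub_neg]
  · exact integrable_comp_of_finite hY fun s => Real.logb 2
      (μ.real ((fun ω => (f (Y ω), g (Y ω), h (Y ω))) ⁻¹' {(f s, g s, h s)}) /
        μ.real ((fun ω => (g (Y ω), h (Y ω))) ⁻¹' {(g s, h s)}))
  · exact integrable_comp_of_finite hY fun s => Real.logb 2
      (μ.real ((fun ω => (f (Y ω), h (Y ω))) ⁻¹' {(f s, h s)}) /
        μ.real ((fun ω => h (Y ω)) ⁻¹' {h s}))

end

end FiniteRange

section ChangeOfMeasure

variable {Ω : Type*} [MeasurableSpace Ω] {μ : Measure Ω} {D : Ω → ℝ} {G : Set Ω}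

lemma measureReal_mul_log_add_one_sub_le_setIntegral_log [IsFiniteMeasure μ]
    (hD : ∀ᵐ ω ∂μ, 0 < D ω) (hinv : Integrable (fun ω => (D ω)⁻¹) μ)
    (hlog : Integrable (fun ω => Real.log (D ω)) μ) (G : Set Ω) {c : ℝ} (hc : 0 < c) :
    μ.real G * (Real.log c + 1) - c * ∫ ω in G, (D ω)⁻¹ ∂μ ≤ ∫ ω in G, Real.log (D ω) ∂μ := by
  have hpoint : ∀ᵐ ω ∂μ, Real.log c + 1 - c * (D ω)⁻¹ ≤ Real.log (D ω) := by
    filter_upwards [hD] with ω hω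
    have hle := Real.log_le_sub_one_of_pos (mul_pos hc (inv_pos.2 hω))
    rw [Real.log_mul hc.ne' (inv_pos.2 hω).ne', Real.log_inv] at hle
    linarith
  have hcinv : Integrable (fun ω => c * (D ω)⁻¹) (μ.restrict G) := hinv.restrict.const_mul c
  calc μ.real G * (Real.log c + 1) - c * ∫ ω in G, (D ω)⁻¹ ∂μ
      = ∫ ω in G, (Real.log c + 1 - c * (D ω)⁻¹) ∂μ := by
        rw [integral_sub (integrable_const _) hcinv, setIntegral_const, smul_eq_mul,
          integral_const_mul]
    _ ≤ ∫ ω in G, Real.log (D ω) ∂μ :=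
        integral_mono_ae ((integrable_const _).sub hcinv) hlog.restrict
          (ae_restrict_of_ae hpoint)

lemma measureReal_mul_log_inv_sub_one_le_integral_log [IsProbabilityMeasure μ]
    (hD : ∀ᵐ ω ∂μ, 0 < D ω) (hinv : Integrable (fun ω => (D ω)⁻¹) μ)
    (hlog : Integrable (fun ω => Real.log (D ω)) μ) (hG : MeasurableSet G) {r : ℝ} (hr : 0 < r)
    (hle_one : ∫ ω, (D ω)⁻¹ ∂μ ≤ 1) (hle : ∫ ω in G, (D ω)⁻¹ ∂μ ≤ r) :
    μ.real G * Real.log r⁻¹ - 1 ≤ ∫ ω, Real.log (D ω) ∂μ := by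
  have hin := measureReal_mul_log_add_one_sub_le_setIntegral_log hD hinv hlog G (inv_pos.2 hr)
  have hout := measureReal_mul_log_add_one_sub_le_setIntegral_log hD hinv hlog Gᶜ one_pos
  have hr_le : r⁻¹ * ∫ ω in G, (D ω)⁻¹ ∂μ ≤ 1 := (inv_mul_le_one₀ hr).2 hle
  have hcompl_le : ∫ ω in Gᶜ, (D ω)⁻¹ ∂μ ≤ 1 :=
    (setIntegral_le_integral hinv (hD.mono fun ω hω => (inv_pos.2 hω).le)).trans hle_one
  have htotal := probReal_add_probReal_compl (μ := μ) hG
  rw [Real.log_one] at hout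
  rw [← integral_add_compl hG hlog]
  linarith

end ChangeOfMeasure

section History

variable {Ω S : Type*} {y : ℕ → Ω → S}

lemma hist_succ_eq_iff {n : ℕ} {ω : Ω} {a : Fin (n + 1) → S} :
    hist y (n + 1) ω = a ↔ y n ω = a (Fin.last n) ∧ hist y n ω = Fin.take n n.le_succ a := by
  constructor
  · rintro rfl
    exact ⟨rfl, rfl⟩
  · rintro ⟨hlast, hinit⟩
    exact funext fun i => Fin.lastCases hlast (fun j => congr_fun hinit j) i

lemma hist_succ_preimage_singleton (n : ℕ) (a : Fin (n + 1) → S) :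
    hist y (n + 1) ⁻¹' {a} =
      y n ⁻¹' {a (Fin.last n)} ∩ hist y n ⁻¹' {Fin.take n n.le_succ a} :=
  Set.ext fun _ => hist_succ_eq_iff

variable [MeasurableSpace Ω] {μ : Measure Ω}

lemma realizedProb_hist_zero (ω : Ω) : realizedProb μ (hist y 0) ω = μ.real Set.univ := by
  have huniv : hist y 0 ⁻¹' {hist y 0 ω} = Set.univ :=
    Set.eq_univ_of_forall fun _ => Subsingleton.elim _ _
  rw [realizedProb, huniv]

lemma realizedProb_hist_succ (n : ℕ) (ω : Ω) :
    realizedProb μ (hist y (n + 1)) ω = realizedProb μ (fun ω => (y n ω, hist y n ω)) ω := by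
  rw [realizedProb, hist_succ_preimage_singleton, ← Set.mk_preimage_prod,
    Set.singleton_prod_singleton]
  rfl

lemma measurable_hist [MeasurableSpace S] (hy : ∀ t, Measurable (y t)) (n : ℕ) :
    Measurable (hist y n) :=
  measurable_pi_lambda _ fun i => hy i

end History

section ChannelProcess

variable {Ω M M' : Type*}

/-- The first `n` inputs together with the first `k` outputs. -/
def jointHist (q : ℕ → Ω → M) (q' : ℕ → Ω → M') (n k : ℕ) (ω : Ω) :
    (Fin n → M) × (Fin k → M') :=
  (hist q n ω, hist q' k ω)

variable [Fintype M']

/-- The causally conditioned likelihood `∏ₜ Q(q'_t | q_{[0,t]}, q'_{[0,t-1]})`: the probability that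
the channel outputs `z.2` when it is fed `z.1`. -/
noncomputable def channelLikelihood (Q : Channel M M') (T : ℕ)
    (z : (Fin T → M) × (Fin T → M')) : ℝ :=
  ∏ t : Fin T, (Q t (Fin.take (t + 1) t.isLt z.1) (Fin.take t t.isLt.le z.2)).1 (z.2 t)

lemma channelLikelihood_succ (Q : Channel M M') (T : ℕ)
    (z : (Fin (T + 1) → M) × (Fin (T + 1) → M')) :
    channelLikelihood Q (T + 1) z =
      channelLikelihood Q T (Fin.take T T.le_succ z.1, Fin.take T T.le_succ z.2) *
        (Q T z.1 (Fin.take T T.le_succ z.2)).1 (z.2 (Fin.last T)) := by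
  simp only [channelLikelihood, Fin.prod_univ_castSucc]
  rfl

lemma channelLikelihood_nonneg (Q : Channel M M') (T : ℕ) (z : (Fin T → M) × (Fin T → M')) :
    0 ≤ channelLikelihood Q T z :=
  Finset.prod_nonneg fun t _ => (Q t _ _).2.1 _

lemma jointPMF_succ [Fintype M] (P : InputPolicy M M') (Q : Channel M M') (T : ℕ)
    (z : (Fin (T + 1) → M) × (Fin (T + 1) → M')) :
    jointPMF P Q (T + 1) z =
      jointPMF P Q T (Fin.take T T.le_succ z.1, Fin.take T T.le_succ z.2) *
        ((P T (Fin.take T T.le_succ z.1) (Fin.take T T.le_succ z.2)).1 (z.1 (Fin.last T)) *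
          (Q T z.1 (Fin.take T T.le_succ z.2)).1 (z.2 (Fin.last T))) := by
  simp only [jointPMF, Fin.prod_univ_castSucc]
  rfl

variable [MeasurableSpace M] [MeasurableSpace M'] [MeasurableSpace Ω]

/-- Under the finite measure `μ`, not necessarily of mass one, `q` and `q'` are the inputs and the
outputs of the channel `Q`: given the past, `q' t` has law `Q t`. -/
structure IsChannelProcess (μ : Measure Ω) (Q : Channel M M') (q : ℕ → Ω → M)
    (q' : ℕ → Ω → M') : Prop where
  measurable_input : ∀ t, Measurable (q t)
  measurable_output : ∀ t, Measurable (q' t)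
  output_law : ∀ t z c, μ.real (q' t ⁻¹' {c} ∩ jointHist q q' (t + 1) t ⁻¹' {z}) =
    (Q t z.1 z.2).1 c * μ.real (jointHist q q' (t + 1) t ⁻¹' {z})

/-- The likelihood of the first `T` outputs given the inputs, over their marginal probability: the
logarithm of this ratio is the density of the directed information. -/
noncomputable def likelihoodRatio (μ : Measure Ω) (Q : Channel M M') (q : ℕ → Ω → M)
    (q' : ℕ → Ω → M') (T : ℕ) (ω : Ω) : ℝ :=
  channelLikelihood Q T (jointHist q q' T T ω) / realizedProb μ (hist q' T) ω

namespace IsChannelProcess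

variable {μ : Measure Ω} {Q : Channel M M'} {q : ℕ → Ω → M} {q' : ℕ → Ω → M'}

lemma measurable_jointHist (h : IsChannelProcess μ Q q q') (n k : ℕ) :
    Measurable (jointHist q q' n k) :=
  (measurable_hist h.measurable_input n).prodMk (measurable_hist h.measurable_output k)

lemma realizedProb_output (h : IsChannelProcess μ Q q q') (t : ℕ) (ω : Ω) :
    realizedProb μ (fun ω => (q' t ω, jointHist q q' (t + 1) t ω)) ω =
      (Q t (hist q (t + 1) ω) (hist q' t ω)).1 (q' t ω) *
        realizedProb μ (jointHist q q' (t + 1) t) ω := by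
  rw [realizedProb, ← Set.singleton_prod_singleton, Set.mk_preimage_prod]
  exact h.output_law t _ _

section Finite

variable [Finite M] [IsFiniteMeasure μ]

lemma ae_output_pos (h : IsChannelProcess μ Q q q') (t : ℕ) :
    ∀ᵐ ω ∂μ, 0 < (Q t (hist q (t + 1) ω) (hist q' t ω)).1 (q' t ω) := by
  filter_upwards [ae_realizedProb_pos fun ω => (q' t ω, jointHist q q' (t + 1) t ω)] with ω hω
  rw [h.realizedProb_output] at hω
  exact pos_of_mul_pos_left hω measureReal_nonneg

lemma ae_channelLikelihood_pos (h : IsChannelProcess μ Q q q') (T : ℕ) :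
    ∀ᵐ ω ∂μ, 0 < channelLikelihood Q T (jointHist q q' T T ω) := by
  filter_upwards [ae_all_iff.2 h.ae_output_pos] with ω hω
  exact Finset.prod_pos fun t _ => hω t

lemma ae_likelihoodRatio_pos (h : IsChannelProcess μ Q q q') (T : ℕ) :
    ∀ᵐ ω ∂μ, 0 < likelihoodRatio μ Q q q' T ω := by
  filter_upwards [h.ae_channelLikelihood_pos T, ae_realizedProb_pos (hist q' T)] with ω hK hF
  exact div_pos hK hF

variable [MeasurableSingletonClass M] [MeasurableSingletonClass M']

lemma integrable_comp_likelihoodRatio (h : IsChannelProcess μ Q q q') (T : ℕ) (φ : ℝ → ℝ) :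
    Integrable (fun ω => φ (likelihoodRatio μ Q q q' T ω)) μ :=
  integrable_comp_of_finite (h.measurable_jointHist T T) fun z =>
    φ (channelLikelihood Q T z / μ.real (hist q' T ⁻¹' {z.2}))

lemma setIntegral_output (h : IsChannelProcess μ Q q q') (t : ℕ) (c : M')
    (g : (Fin (t + 1) → M) × (Fin t → M') → ℝ) :
    ∫ ω in q' t ⁻¹' {c}, g (jointHist q q' (t + 1) t ω) ∂μ =
      ∫ ω, (Q t (hist q (t + 1) ω) (hist q' t ω)).1 c * g (jointHist q q' (t + 1) t ω) ∂μ := by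
  have := Fintype.ofFinite M
  have hJ := h.measurable_jointHist (t + 1) t
  refine (integral_comp_eq_sum hJ g).trans
    (.trans ?_ (integral_comp_eq_sum hJ fun z => (Q t z.1 z.2).1 c * g z).symm)
  refine Finset.sum_congr rfl fun z _ => ?_
  rw [measureReal_restrict_apply (hJ (measurableSet_singleton z)), Set.inter_comm, h.output_law]
  ring

lemma setIntegral_div_output_le (h : IsChannelProcess μ Q q q') (t : ℕ) (c : M')
    {g : (Fin (t + 1) → M) × (Fin t → M') → ℝ} (hg : 0 ≤ g) :
    ∫ ω in q' t ⁻¹' {c}, g (jointHist q q' (t + 1) t ω) /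
        (Q t (hist q (t + 1) ω) (hist q' t ω)).1 (q' t ω) ∂μ ≤
      ∫ ω, g (jointHist q q' (t + 1) t ω) ∂μ := by
  have hJ := h.measurable_jointHist (t + 1) t
  calc _ = ∫ ω in q' t ⁻¹' {c}, g (jointHist q q' (t + 1) t ω) /
        (Q t (hist q (t + 1) ω) (hist q' t ω)).1 c ∂μ :=
        setIntegral_congr_fun (h.measurable_output t (measurableSet_singleton c))
          fun ω (hω : q' t ω = c) => by simp only [hω]
    _ = ∫ ω, (Q t (hist q (t + 1) ω) (hist q' t ω)).1 c * (g (jointHist q q' (t + 1) t ω) /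
        (Q t (hist q (t + 1) ω) (hist q' t ω)).1 c) ∂μ :=
        h.setIntegral_output t c fun z => g z / (Q t z.1 z.2).1 c
    _ ≤ _ := integral_mono
        (integrable_comp_of_finite hJ fun z => (Q t z.1 z.2).1 c * (g z / (Q t z.1 z.2).1 c))
        (integrable_comp_of_finite hJ g) fun ω => by
          rw [mul_div_left_comm]
          exact mul_le_of_le_one_right (hg _) (div_self_le_one _)

lemma setIntegral_inv_channelLikelihood_le (h : IsChannelProcess μ Q q q') (T : ℕ)
    (b : Fin T → M') :
    ∫ ω in hist q' T ⁻¹' {b}, (channelLikelihood Q T (jointHist q q' T T ω))⁻¹ ∂μ ≤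
      μ.real Set.univ := by
  induction T with
  | zero =>
    simpa [channelLikelihood] using measureReal_mono (μ := μ) (Set.subset_univ _)
  | succ T ih =>
    have hfibre (b' : Fin T → M') : MeasurableSet (hist q' T ⁻¹' {b'}) :=
      measurable_hist h.measurable_output T (measurableSet_singleton b')
    let g : (Fin (T + 1) → M) × (Fin T → M') → ℝ :=
      {z | z.2 = Fin.take T T.le_succ b}.indicator fun z =>
        (channelLikelihood Q T (Fin.take T T.le_succ z.1, z.2))⁻¹
    have hg : 0 ≤ g := Set.indicator_nonneg fun z _ => inv_nonneg.2 (channelLikelihood_nonneg Q T _)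
    refine (le_trans (le_of_eq ?_) (h.setIntegral_div_output_le T (b (Fin.last T)) hg)).trans
      ((integral_indicator (hfibre _)).trans_le (ih (Fin.take T T.le_succ b)))
    rw [hist_succ_preimage_singleton, ← setIntegral_indicator (hfibre _)]
    congr 1 with ω
    by_cases hω : ω ∈ hist q' T ⁻¹' {Fin.take T T.le_succ b}
    · have hgω : g (jointHist q q' (T + 1) T ω) =
          (channelLikelihood Q T (jointHist q q' T T ω))⁻¹ :=
        Set.indicator_of_mem (by exact hω) _
      rw [hgω, Set.indicator_of_mem hω, channelLikelihood_succ, mul_inv, div_eq_mul_inv]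
      rfl
    · have hgω : g (jointHist q q' (T + 1) T ω) = 0 := Set.indicator_of_notMem (by exact hω) _
      rw [hgω, Set.indicator_of_notMem hω, zero_div]

end Finite

section DirectedInfo

variable [Fintype M] [MeasurableSingletonClass M]

lemma exists_inputPolicy [IsProbabilityMeasure μ] (h : IsChannelProcess μ Q q q') :
    ∃ P : InputPolicy M M', ∀ T, jointPMF P Q T =
      fun z => μ.real (jointHist q q' T T ⁻¹' {z}) := by
  choose P hP using fun (t : ℕ) (a : Fin t → M) (b : Fin t → M') =>
    exists_stdSimplex_measureReal_inter_eq_mul (μ := μ) (h.measurable_input t)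
      (jointHist q q' t t ⁻¹' {(a, b)})
  refine ⟨P, fun T => ?_⟩
  induction T with
  | zero =>
    funext z
    have huniv : jointHist q q' 0 0 ⁻¹' {z} = Set.univ :=
      Set.preimage_eq_univ_iff.2 fun _ _ => Subsingleton.elim _ _
    simp [jointPMF, huniv]
  | succ T ih =>
    funext z
    have houtput : jointHist q q' (T + 1) (T + 1) ⁻¹' {z} = q' T ⁻¹' {z.2 (Fin.last T)} ∩
        jointHist q q' (T + 1) T ⁻¹' {(z.1, Fin.take T T.le_succ z.2)} := by
      ext ω
      simp only [jointHist, Set.mem_preimage, Set.mem_inter_iff, Set.mem_singleton_iff,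
        Prod.ext_iff, hist_succ_eq_iff (y := q')]
      tauto
    have hinput : jointHist q q' (T + 1) T ⁻¹' {(z.1, Fin.take T T.le_succ z.2)} =
        q T ⁻¹' {z.1 (Fin.last T)} ∩
          jointHist q q' T T ⁻¹' {(Fin.take T T.le_succ z.1, Fin.take T T.le_succ z.2)} := by
      ext ω
      simp only [jointHist, Set.mem_preimage, Set.mem_inter_iff, Set.mem_singleton_iff,
        Prod.ext_iff, hist_succ_eq_iff (y := q)]
      tauto
    rw [jointPMF_succ, ih, houtput, h.output_law, hinput, hP]
    ring

variable [MeasurableSingletonClass M']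

lemma condMutualInfo_output [IsFiniteMeasure μ] (h : IsChannelProcess μ Q q q') {T : ℕ}
    (t : Fin T) :
    condMutualInfo (fun z => μ.real (jointHist q q' T T ⁻¹' {z})) (fun z => z.2 t)
        (fun z => Fin.take (t + 1) t.isLt z.1) (fun z => Fin.take t t.isLt.le z.2) =
      (∫ ω, Real.logb 2 (likelihoodRatio μ Q q q' (t + 1) ω) ∂μ) -
        ∫ ω, Real.logb 2 (likelihoodRatio μ Q q q' t ω) ∂μ := by
  rw [condMutualInfo_measureReal_preimage (h.measurable_jointHist T T),
    ← integral_sub (h.integrable_comp_likelihoodRatio _ _) (h.integrable_comp_likelihoodRatio _ _)]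
  refine integral_congr_ae ?_
  filter_upwards [h.ae_output_pos t, h.ae_channelLikelihood_pos t,
    ae_realizedProb_pos (μ := μ) (jointHist q q' (t + 1) t),
    ae_realizedProb_pos (μ := μ) (hist q' t),
    ae_realizedProb_pos (μ := μ) (hist q' (t + 1))] with ω hQ hK hJ hF hF'
  have hcond : realizedProb μ (fun ω => (q' t ω, jointHist q q' (t + 1) t ω)) ω /
      realizedProb μ (jointHist q q' (t + 1) t) ω =
        (Q t (hist q (t + 1) ω) (hist q' t ω)).1 (q' t ω) := by
    rw [h.realizedProb_output, mul_div_cancel_right₀ _ hJ.ne']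
  have hK' : channelLikelihood Q (t + 1) (jointHist q q' (t + 1) (t + 1) ω) =
      channelLikelihood Q t (jointHist q q' t t ω) *
        (Q t (hist q (t + 1) ω) (hist q' t ω)).1 (q' t ω) :=
    channelLikelihood_succ Q t _
  change Real.logb 2 (realizedProb μ (fun ω => (q' t ω, jointHist q q' (t + 1) t ω)) ω /
      realizedProb μ (jointHist q q' (t + 1) t) ω) -
    Real.logb 2 (realizedProb μ (fun ω => (q' t ω, hist q' t ω)) ω /
      realizedProb μ (hist q' t) ω) = _
  rw [hcond, ← realizedProb_hist_succ, likelihoodRatio, likelihoodRatio, hK',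
    Real.logb_div hF'.ne' hF.ne', Real.logb_div (mul_pos hK hQ).ne' hF'.ne',
    Real.logb_div hK.ne' hF.ne', Real.logb_mul hK.ne' hQ.ne']
  ring

variable [IsProbabilityMeasure μ]

lemma directedInfo_eq_integral_logb (h : IsChannelProcess μ Q q q') {P : InputPolicy M M'} {T : ℕ}
    (hP : jointPMF P Q T = fun z => μ.real (jointHist q q' T T ⁻¹' {z})) :
    directedInfo P Q T = ∫ ω, Real.logb 2 (likelihoodRatio μ Q q q' T ω) ∂μ := by
  simp only [directedInfo, hP, h.condMutualInfo_output]
  rw [Fin.sum_univ_eq_sum_range fun t =>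
    (∫ ω, Real.logb 2 (likelihoodRatio μ Q q q' (t + 1) ω) ∂μ) -
      ∫ ω, Real.logb 2 (likelihoodRatio μ Q q q' t ω) ∂μ,
    Finset.sum_range_sub fun t => ∫ ω, Real.logb 2 (likelihoodRatio μ Q q q' t ω) ∂μ,
    sub_eq_self]
  simp [likelihoodRatio, channelLikelihood, realizedProb_hist_zero]

end DirectedInfo

section Converse

variable [MeasurableSingletonClass M] [MeasurableSingletonClass M'] {G : Set Ω} {T : ℕ} {r : ℝ}

lemma setIntegral_inter_inv_channelLikelihood_le [Finite M] [IsFiniteMeasure μ]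
    (h : IsChannelProcess μ Q q q') {E : Set Ω} (hE : IsChannelProcess (μ.restrict E) Q q q')
    {b : Fin T → M'} (hGE : G ∩ hist q' T ⁻¹' {b} ⊆ E) :
    ∫ ω in hist q' T ⁻¹' {b} ∩ G, (channelLikelihood Q T (jointHist q q' T T ω))⁻¹ ∂μ ≤
      μ.real E := by
  have hint : Integrable (fun ω => (channelLikelihood Q T (jointHist q q' T T ω))⁻¹) μ :=
    integrable_comp_of_finite (h.measurable_jointHist T T) fun z => (channelLikelihood Q T z)⁻¹
  calc ∫ ω in hist q' T ⁻¹' {b} ∩ G, (channelLikelihood Q T (jointHist q q' T T ω))⁻¹ ∂μ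
      ≤ ∫ ω in hist q' T ⁻¹' {b} ∩ E, (channelLikelihood Q T (jointHist q q' T T ω))⁻¹ ∂μ :=
        setIntegral_mono_set hint.integrableOn
          (ae_of_all _ fun ω => inv_nonneg.2 (channelLikelihood_nonneg Q T _))
          (LE.le.eventuallyLE fun ω hω => ⟨hω.1, hGE hω.symm⟩)
    _ = ∫ ω in hist q' T ⁻¹' {b}, (channelLikelihood Q T (jointHist q q' T T ω))⁻¹
          ∂μ.restrict E := by
        rw [Measure.restrict_restrict
          (measurable_hist h.measurable_output T (measurableSet_singleton b))]
    _ ≤ (μ.restrict E).real Set.univ := hE.setIntegral_inv_channelLikelihood_le T b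
    _ = μ.real E := measureReal_restrict_apply_univ E

lemma setIntegral_inv_likelihoodRatio_le [Finite M] [IsProbabilityMeasure μ]
    (h : IsChannelProcess μ Q q q') (E : Ω → Set Ω)
    (hE : ∀ ω, IsChannelProcess (μ.restrict (E ω)) Q q q')
    (hGE : ∀ ω, G ∩ hist q' T ⁻¹' {hist q' T ω} ⊆ E ω)
    (hEr : ∀ ω, μ.real (E ω) ≤ r) :
    ∫ ω in G, (likelihoodRatio μ Q q q' T ω)⁻¹ ∂μ ≤ r := by
  have hhist : Measurable (hist q' T) := measurable_hist h.measurable_output T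
  have hfibre (b : Fin T → M') : MeasurableSet (hist q' T ⁻¹' {b}) :=
    hhist (measurableSet_singleton b)
  have hfibre_le (b : Fin T → M') :
      ∫ ω in hist q' T ⁻¹' {b}, (likelihoodRatio μ Q q q' T ω)⁻¹ ∂μ.restrict G ≤
        μ.real (hist q' T ⁻¹' {b}) * r := by
    obtain hempty | ⟨ω₀, rfl⟩ := (hist q' T ⁻¹' {b}).eq_empty_or_nonempty
    · simp [hempty]
    · calc ∫ ω in hist q' T ⁻¹' {hist q' T ω₀}, (likelihoodRatio μ Q q q' T ω)⁻¹ ∂μ.restrict G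
          = μ.real (hist q' T ⁻¹' {hist q' T ω₀}) * ∫ ω in hist q' T ⁻¹' {hist q' T ω₀} ∩ G,
              (channelLikelihood Q T (jointHist q q' T T ω))⁻¹ ∂μ := by
            rw [← integral_const_mul, ← Measure.restrict_restrict (hfibre _)]
            refine setIntegral_congr_fun (hfibre _) fun ω (hω : hist q' T ω = hist q' T ω₀) => ?_
            rw [likelihoodRatio, realizedProb, hω, inv_div, div_eq_mul_inv]
        _ ≤ μ.real (hist q' T ⁻¹' {hist q' T ω₀}) * r := by
            gcongr
            exact (h.setIntegral_inter_inv_channelLikelihood_le (hE ω₀) (hGE ω₀)).trans (hEr ω₀)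
  calc ∫ ω in G, (likelihoodRatio μ Q q q' T ω)⁻¹ ∂μ
      = ∑ b, ∫ ω in hist q' T ⁻¹' {b}, (likelihoodRatio μ Q q q' T ω)⁻¹ ∂μ.restrict G :=
        integral_eq_sum_setIntegral_fiber hhist
          (h.integrable_comp_likelihoodRatio T (·⁻¹)).restrict
    _ ≤ ∑ b, μ.real (hist q' T ⁻¹' {b}) * r := Finset.sum_le_sum fun b _ => hfibre_le b
    _ = r := by simpa using (integral_comp_eq_sum (μ := μ) hhist fun _ => r).symm

lemma measureReal_mul_logb_sub_le_directedInfo [Fintype M] [IsProbabilityMeasure μ]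
    (h : IsChannelProcess μ Q q q') {P : InputPolicy M M'}
    (hP : jointPMF P Q T = fun z => μ.real (jointHist q q' T T ⁻¹' {z}))
    (hG : MeasurableSet G) (E : Ω → Set Ω)
    (hE : ∀ ω, IsChannelProcess (μ.restrict (E ω)) Q q q')
    (hGE : ∀ ω, G ∩ hist q' T ⁻¹' {hist q' T ω} ⊆ E ω) (hr : 0 < r)
    (hEr : ∀ ω, μ.real (E ω) ≤ r) :
    μ.real G * Real.logb 2 r⁻¹ - (Real.log 2)⁻¹ ≤ directedInfo P Q T := by
  have hle_one : ∫ ω, (likelihoodRatio μ Q q q' T ω)⁻¹ ∂μ ≤ 1 := by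
    simpa using h.setIntegral_inv_likelihoodRatio_le (G := Set.univ) (fun _ => Set.univ)
      (fun _ => by simpa using h) (fun _ => Set.subset_univ _) (fun _ => by simp)
  have hlog := measureReal_mul_log_inv_sub_one_le_integral_log (h.ae_likelihoodRatio_pos T)
    (h.integrable_comp_likelihoodRatio T (·⁻¹)) (h.integrable_comp_likelihoodRatio T Real.log) hG hr
    hle_one (h.setIntegral_inv_likelihoodRatio_le E hE hGE hEr)
  rw [h.directedInfo_eq_integral_logb hP]
  calc μ.real G * Real.logb 2 r⁻¹ - (Real.log 2)⁻¹
      = (μ.real G * Real.log r⁻¹ - 1) / Real.log 2 := by rw [Real.logb]; ring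
    _ ≤ (∫ ω, Real.log (likelihoodRatio μ Q q q' T ω) ∂μ) / Real.log 2 := by gcongr
    _ = ∫ ω, Real.logb 2 (likelihoodRatio μ Q q q' T ω) ∂μ := (integral_div _ _).symm

end Converse

end IsChannelProcess

end ChannelProcess

section ConditionalProbability

lemma measureReal_inter_of_condExp {Ω : Type*} {m mΩ : MeasurableSpace Ω} {μ : Measure Ω}
    [IsFiniteMeasure μ] (hm : m ≤ mΩ) {s G : Set Ω} (hs : MeasurableSet s)
    (hG : MeasurableSet[m] G) {f : Ω → ℝ} (h : μ⟦s | m⟧ =ᵐ[μ] f) {k : ℝ}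
    (hk : ∀ ω ∈ G, f ω = k) : μ.real (s ∩ G) = k * μ.real G := by
  have hint : Integrable (s.indicator fun _ => (1 : ℝ)) μ := (integrable_const 1).indicator hs
  calc μ.real (s ∩ G) = ∫ ω in G, s.indicator (fun _ => (1 : ℝ)) ω ∂μ := by
        rw [integral_indicator_const _ hs, measureReal_restrict_apply hs, smul_eq_mul, mul_one]
    _ = ∫ ω in G, (μ⟦s | m⟧) ω ∂μ := (setIntegral_condExp hm hint hG).symm
    _ = ∫ _ in G, k ∂μ :=
        setIntegral_congr_ae (hm _ hG) (h.mono fun ω hω hωG => hω.trans (hk ω hωG))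
    _ = k * μ.real G := by rw [setIntegral_const, smul_eq_mul, mul_comm]

end ConditionalProbability

section LinearSystem

open scoped Matrix

variable {n R : Type*} [Fintype n]

/-- The state at time `t` of the system `x_{s+1} = A x_s + v_s` started at rest. -/
def forcedResponse [NonUnitalNonAssocSemiring R] (A : Matrix n n R) (v : ℕ → n → R) : ℕ → n → R
  | 0 => 0
  | t + 1 => A *ᵥ forcedResponse A v t + v t

lemma eq_pow_mulVec_add_forcedResponse [DecidableEq n] [Semiring R] {A : Matrix n n R}
    {x v : ℕ → n → R} (hx : ∀ t, x (t + 1) = A *ᵥ x t + v t) (t : ℕ) :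
    x t = A ^ t *ᵥ x 0 + forcedResponse A v t := by
  induction t with
  | zero => simp [forcedResponse]
  | succ t ih =>
    rw [hx, ih, forcedResponse, Matrix.mulVec_add, Matrix.mulVec_mulVec, ← pow_succ', add_assoc]

lemma forcedResponse_congr [NonUnitalNonAssocSemiring R] (A : Matrix n n R) {v v' : ℕ → n → R}
    {t : ℕ} (h : ∀ s < t, v s = v' s) : forcedResponse A v t = forcedResponse A v' t := by
  induction t with
  | zero => rfl
  | succ t ih =>
    rw [forcedResponse, forcedResponse, h t t.lt_succ_self,
      ih fun s hs => h s (hs.trans t.lt_succ_self)]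

lemma measurable_mulVec {m : Type*} (A : Matrix m n ℝ) : Measurable (A *ᵥ ·) := by
  unfold Matrix.mulVec dotProduct
  fun_prop

lemma measurable_forcedResponse (A : Matrix n n ℝ) (t : ℕ) :
    Measurable fun v : ℕ → n → ℝ => forcedResponse A v t := by
  induction t with
  | zero => exact measurable_const
  | succ t ih => exact ((measurable_mulVec A).comp ih).add (measurable_pi_apply t)

end LinearSystem

section BoundedDensity

lemma exists_nat_lt_measureReal_setOf_le {α : Type*} [MeasurableSpace α] {P : Measure α}
    [IsProbabilityMeasure P] {f : α → ENNReal} (hf : ∀ᵐ a ∂P, f a ≠ ⊤) {ε : ℝ}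
    (hε : 0 < ε) : ∃ n : ℕ, 1 - ε < P.real {a | f a ≤ n} := by
  have hunion : P (⋃ n : ℕ, {a | f a ≤ n}) = 1 := by
    rw [← measure_univ (μ := P)]
    refine measure_congr (eventuallyEq_univ.2 (hf.mono fun a ha => ?_))
    obtain ⟨n, hn⟩ := ENNReal.exists_nat_gt ha
    exact Set.mem_iUnion.2 ⟨n, hn.le⟩
  have hmono : Monotone fun n : ℕ => {a | f a ≤ n} := fun i j hij a (ha : f a ≤ i) =>
    ha.trans (Nat.cast_le.2 hij)
  have hlim : Tendsto (fun n : ℕ => P.real {a | f a ≤ n}) atTop (𝓝 1) := by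
    have := tendsto_measure_iUnion_atTop (μ := P) hmono
    rw [hunion] at this
    exact (ENNReal.tendsto_toReal ENNReal.one_ne_top).comp this
  exact (hlim.eventually (lt_mem_nhds (by linarith))).exists

lemma exists_nat_frequently_lt_measureReal_inter {α ι : Type*} [MeasurableSpace α] {P : Measure α}
    [IsProbabilityMeasure P] {f : α → ENNReal} (hfm : Measurable f) (hf : ∀ᵐ a ∂P, f a ≠ ⊤)
    {l : Filter ι} {s : ι → Set α} {c ε : ℝ} (hε : 0 < ε) (hs : ∃ᶠ i in l, c < P.real (s i)) :
    ∃ n : ℕ, ∃ᶠ i in l, c - ε < P.real ({a | f a ≤ n} ∩ s i) := by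
  obtain ⟨n, hn⟩ := exists_nat_lt_measureReal_setOf_le hf hε
  refine ⟨n, hs.mono fun i hi => ?_⟩
  have hmeas : MeasurableSet {a | f a ≤ n} := measurableSet_le hfm measurable_const
  have hadd : P.real ({a | f a ≤ n} ∪ s i) + P.real ({a | f a ≤ n} ∩ s i) =
      P.real {a | f a ≤ n} + P.real (s i) := measureReal_union_add_inter' hmeas
  have hunion : P.real ({a | f a ≤ n} ∪ s i) ≤ 1 := measureReal_le_one
  linarith

lemma measure_setOf_rnDeriv_le_inter_le {α : Type*} [MeasurableSpace α] {P ν : Measure α}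
    [P.HaveLebesgueDecomposition ν] [SFinite ν] (hac : P ≪ ν) (L : ENNReal) (s : Set α) :
    P ({a | P.rnDeriv ν a ≤ L} ∩ s) ≤ L * ν s :=
  calc P ({a | P.rnDeriv ν a ≤ L} ∩ s)
      = ∫⁻ a in {a | P.rnDeriv ν a ≤ L} ∩ s, P.rnDeriv ν a ∂ν :=
        (Measure.setLIntegral_rnDeriv hac _).symm
    _ ≤ ∫⁻ _ in {a | P.rnDeriv ν a ≤ L} ∩ s, L ∂ν :=
        setLIntegral_mono measurable_const fun _ ha => ha.1
    _ = L * ν ({a | P.rnDeriv ν a ≤ L} ∩ s) := setLIntegral_const _ _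
    _ ≤ L * ν s := by gcongr; exact Set.inter_subset_right

variable {Ω E : Type*} [MeasurableSpace Ω] {μ : Measure Ω} [IsProbabilityMeasure μ]
  [NormedAddCommGroup E] [NormedSpace ℝ E] [FiniteDimensional ℝ E] [MeasurableSpace E]
  [BorelSpace E] (ν : Measure E) [ν.IsAddHaarMeasure]

lemma measure_rnDeriv_le_and_linearMap_add_mem_le {X Y : Ω → E} (hX : Measurable X)
    (hY : Measurable Y) (hXY : IndepFun X Y μ) (hac : μ.map X ≪ ν) {f : E →ₗ[ℝ] E}
    (hf : LinearMap.det f ≠ 0) (L : ENNReal) {K : Set E} (hK : MeasurableSet K) :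
    μ {ω | (μ.map X).rnDeriv ν (X ω) ≤ L ∧ f (X ω) + Y ω ∈ K} ≤
      L * (ENNReal.ofReal |(LinearMap.det f)⁻¹| * ν K) := by
  have : IsProbabilityMeasure (μ.map X) := Measure.isProbabilityMeasure_map hX.aemeasurable
  have : IsProbabilityMeasure (μ.map Y) := Measure.isProbabilityMeasure_map hY.aemeasurable
  set S : Set (E × E) := {p | (μ.map X).rnDeriv ν p.1 ≤ L ∧ f p.1 + p.2 ∈ K}
  have hS : MeasurableSet S :=
    (measurableSet_le ((Measure.measurable_rnDeriv _ _).comp measurable_fst)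
      measurable_const).inter
      (((f.continuous_of_finiteDimensional.measurable.comp measurable_fst).add measurable_snd) hK)
  have hslice (y : E) : μ.map X ((fun x => (x, y)) ⁻¹' S) ≤
      L * (ENNReal.ofReal |(LinearMap.det f)⁻¹| * ν K) := by
    refine (measure_setOf_rnDeriv_le_inter_le hac L (f ⁻¹' ((· + y) ⁻¹' K))).trans_eq ?_
    rw [Measure.addHaar_preimage_linearMap _ hf, measure_preimage_add_right]
  calc μ {ω | (μ.map X).rnDeriv ν (X ω) ≤ L ∧ f (X ω) + Y ω ∈ K}
      = μ.map (fun ω => (X ω, Y ω)) S := (Measure.map_apply (hX.prodMk hY) hS).symm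
    _ = ∫⁻ y, μ.map X ((fun x => (x, y)) ⁻¹' S) ∂μ.map Y := by
        rw [(indepFun_iff_map_prod_eq_prod_map_map hX.aemeasurable hY.aemeasurable).1 hXY,
          Measure.prod_apply_symm hS]
    _ ≤ ∫⁻ _, L * (ENNReal.ofReal |(LinearMap.det f)⁻¹| * ν K) ∂μ.map Y := lintegral_mono hslice
    _ = L * (ENNReal.ofReal |(LinearMap.det f)⁻¹| * ν K) := by simp

end BoundedDensity

section Capacity

variable {M M' : Type*} [Fintype M] [Fintype M']

lemma HasFeedbackCapacity.le_of_frequently {Q : Channel M M'} {C a b : ℝ}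
    (hC : HasFeedbackCapacity Q C)
    (h : ∃ᶠ T : ℕ in atTop, ∃ P : InputPolicy M M', a * T - b ≤ directedInfo P Q T) : a ≤ C := by
  obtain ⟨R, hR, hlim⟩ := hC
  have hlim' : Tendsto (fun T : ℕ => R T + b / T) atTop (𝓝 C) := by
    simpa using hlim.add (tendsto_const_div_atTop_nhds_zero_nat b)
  refine ge_of_tendsto_of_frequently hlim' ((h.and_eventually (eventually_gt_atTop 0)).mono ?_)
  rintro T ⟨⟨P, hP⟩, hT⟩
  have : (T : ℝ) ≠ 0 := Nat.cast_ne_zero.2 hT.ne'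
  have hle : 1 / (T : ℝ) * directedInfo P Q T ≤ R T := (hR T).2 ⟨P, rfl⟩
  calc a = 1 / (T : ℝ) * (a * T - b) + b / T := by field_simp; ring
    _ ≤ 1 / (T : ℝ) * directedInfo P Q T + b / T := by gcongr
    _ ≤ R T + b / T := by gcongr

end Capacity

section AsymptoticMeanStationarity

lemma frequently_lt_of_tendsto_cesaro {a : ℕ → ℝ} {c l : ℝ}
    (h : Tendsto (fun n : ℕ => (1 / (n : ℝ)) * ∑ k ∈ Finset.range n, a k) atTop (𝓝 l))
    (hc : c < l) : ∃ᶠ k in atTop, c < a k := by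
  intro hle
  have hmax : Tendsto (fun k => max (a k) c) atTop (𝓝 c) :=
    tendsto_const_nhds.congr' (hle.mono fun k hk => (max_eq_right (not_lt.1 hk)).symm)
  refine hc.not_ge (le_of_tendsto_of_tendsto' h hmax.cesaro fun n => ?_)
  rw [one_div]
  gcongr
  exact le_max_left _ _

variable {X : Type*}

lemma seqShift_iterate_apply (k n : ℕ) (z : ℕ → X) : seqShift^[k] z n = z (n + k) := by
  induction k generalizing z with
  | zero => rfl
  | succ k ih => rw [Function.iterate_succ_apply, ih, seqShift, add_assoc]

lemma IsAMS.exists_isCompact_frequently [TopologicalSpace X] [PolishSpace X] [MeasurableSpace X]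
    [BorelSpace X] {P : Measure (ℕ → X)} (h : IsAMS P) {ε : ℝ} (hε : 0 < ε) :
    ∃ K : Set X, IsCompact K ∧ ∃ᶠ T in atTop, 1 - ε < P.real {z | z T ∈ K} := by
  obtain ⟨Pbar, hPbar, hlim⟩ := h
  have : IsProbabilityMeasure (Pbar.map (· 0)) :=
    Measure.isProbabilityMeasure_map (measurable_pi_apply 0).aemeasurable
  obtain ⟨K, hK, hPbarK⟩ := isTightMeasureSet_iff_exists_isCompact_measure_compl_le.1
    (isTightMeasureSet_singleton (μ := Pbar.map (· 0))) (ENNReal.ofReal (ε / 2)) (by simpa)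
  have hfst : MeasurableSet {z : ℕ → X | z 0 ∈ K} := measurable_pi_apply 0 hK.measurableSet
  have hlt : 1 - ε < Pbar.real {z | z 0 ∈ K} := by
    have hcompl : (Pbar.map (· 0)).real Kᶜ ≤ ε / 2 :=
      ENNReal.toReal_le_of_le_ofReal (by positivity) (hPbarK _ rfl)
    rw [probReal_compl_eq_one_sub hK.measurableSet,
      map_measureReal_apply (measurable_pi_apply 0) hK.measurableSet] at hcompl
    change 1 - Pbar.real {z | z 0 ∈ K} ≤ ε / 2 at hcompl
    linarith
  refine ⟨K, hK, frequently_lt_of_tendsto_cesaro ?_ hlt⟩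
  simpa only [Set.preimage_ofPred_eq, seqShift_iterate_apply, zero_add] using hlim _ hfst

end AsymptoticMeanStationarity

lemma sub_mul_abs_sub_abs_le_mul_sub {R : Type*} [CommRing R] [LinearOrder R]
    [IsStrictOrderedRing R] {g ε : R} (hg : 0 ≤ g) (hg_le : g ≤ 1) (hε : 1 - ε ≤ g) (a b : R) :
    a - ε * |a| - |b| ≤ g * (a - b) := by
  have ha : (1 - g) * a ≤ ε * |a| := calc
    (1 - g) * a ≤ (1 - g) * |a| := mul_le_mul_of_nonneg_left (le_abs_self a) (sub_nonneg.2 hg_le)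
    _ ≤ ε * |a| := mul_le_mul_of_nonneg_right (sub_le_comm.1 hε) (abs_nonneg a)
  have hb : g * b ≤ |b| := calc
    g * b ≤ g * |b| := mul_le_mul_of_nonneg_left (le_abs_self b) hg
    _ ≤ |b| := mul_le_of_le_one_left (abs_nonneg b) hg_le
  linarith

section Eigenvalues

lemma sum_map_logb_norm {b : ℝ} {s : Multiset ℂ} (hs : 0 ∉ s) :
    (s.map fun z => Real.logb b ‖z‖).sum = Real.logb b ‖s.prod‖ := by
  have hnorm : ∀ r ∈ s.map (‖·‖), r ≠ 0 := by
    simp only [Multiset.mem_map, forall_exists_index, and_imp, forall_apply_eq_imp_iff₂]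
    exact fun z hz => norm_ne_zero_iff.2 fun h0 => hs (h0 ▸ hz)
  have hprod : ‖s.prod‖ = (s.map (‖·‖)).prod := map_multiset_prod normHom s
  simp only [hprod, Real.logb, Real.log_multiset_prod hnorm, Multiset.map_map, Multiset.sum_map_div,
    Function.comp_apply]

variable {n : Type*} [Fintype n] [DecidableEq n]

lemma norm_prod_aroots_charpoly (A : Matrix n n ℝ) : ‖(A.charpoly.aroots ℂ).prod‖ = |A.det| := by
  rw [Polynomial.aroots, ← Matrix.charpoly_map, ← Matrix.det_eq_prod_roots_charpoly,
    ← RingHom.mapMatrix_apply, ← RingHom.map_det]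
  simp

end Eigenvalues

section OpenLoop

open scoped Matrix

variable {N : ℕ} {A : Matrix (Fin N) (Fin N) ℝ} {P : Measure (Fin N → ℝ)}

/-- The initial states and noise sequences that drive the state into `K` at time `T` under the fixed
inputs `v`, among the initial states where the density of `P` is at most `L`. -/
def openLoopSources (A : Matrix (Fin N) (Fin N) ℝ) (P : Measure (Fin N → ℝ)) (L : ENNReal)
    (v : ℕ → Fin N → ℝ) (T : ℕ) (K : Set (Fin N → ℝ)) :
    Set ((Fin N → ℝ) × (ℕ → Fin N → ℝ)) :=
  {p | P.rnDeriv volume p.1 ≤ L ∧ A ^ T *ᵥ p.1 + forcedResponse A (fun s => v s + p.2 s) T ∈ K}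

lemma measurable_forcedResponse_add (A : Matrix (Fin N) (Fin N) ℝ) (v : ℕ → Fin N → ℝ) (T : ℕ) :
    Measurable fun z : ℕ → Fin N → ℝ => forcedResponse A (fun s => v s + z s) T :=
  (measurable_forcedResponse A T).comp
    (measurable_pi_lambda _ fun s => measurable_const.add (measurable_pi_apply s))

lemma measurableSet_openLoopSources (L : ENNReal) (v : ℕ → Fin N → ℝ) (T : ℕ)
    {K : Set (Fin N → ℝ)} (hK : MeasurableSet K) : MeasurableSet (openLoopSources A P L v T K) :=
  (measurableSet_le ((Measure.measurable_rnDeriv _ _).comp measurable_fst) measurable_const).inter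
    ((((measurable_mulVec (A ^ T)).comp measurable_fst).add
      ((measurable_forcedResponse_add A v T).comp measurable_snd)) hK)

variable {Ω : Type*} [MeasurableSpace Ω] {μ : Measure Ω} [IsProbabilityMeasure μ]

lemma measureReal_preimage_openLoopSources_le {X : Ω → Fin N → ℝ} {W : Ω → ℕ → Fin N → ℝ}
    (hX : Measurable X) (hW : Measurable W) (hXW : IndepFun X W μ) (hac : μ.map X ≪ volume)
    (hdet : A.det ≠ 0) (L : ℕ) (v : ℕ → Fin N → ℝ) (T : ℕ) {K : Set (Fin N → ℝ)}
    (hK : MeasurableSet K) (hKfin : volume K ≠ ⊤) :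
    μ.real ((fun ω => (X ω, W ω)) ⁻¹' openLoopSources A (μ.map X) L v T K) ≤
      L * volume.real K / |A.det| ^ T := by
  have hforced := measurable_forcedResponse_add A v T
  have hdetT : LinearMap.det (Matrix.toLin' (A ^ T)) = A.det ^ T := by
    rw [LinearMap.det_toLin', Matrix.det_pow]
  have hle := measure_rnDeriv_le_and_linearMap_add_mem_le volume hX (hforced.comp hW)
    (hXW.comp measurable_id hforced) hac (hdetT ▸ pow_ne_zero T hdet) L hK
  rw [hdetT] at hle
  calc μ.real ((fun ω => (X ω, W ω)) ⁻¹' openLoopSources A (μ.map X) L v T K)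
      ≤ (L * (ENNReal.ofReal |(A.det ^ T)⁻¹| * volume K)).toReal :=
        ENNReal.toReal_mono (by finiteness) hle
    _ = L * volume.real K / |A.det| ^ T := by
        rw [ENNReal.toReal_mul, ENNReal.toReal_mul, ENNReal.toReal_natCast,
          ENNReal.toReal_ofReal (abs_nonneg _), abs_inv, abs_pow, Measure.real]
        ring

end OpenLoop

namespace IsClosedLoop

open scoped Matrix

variable {N m : ℕ} {M M' : Type*} [MeasurableSpace M] [Fintype M'] [MeasurableSpace M']
  {Ω : Type*} [MeasurableSpace Ω] {μ : Measure Ω}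
  {A : Matrix (Fin N) (Fin N) ℝ} {B : Matrix (Fin N) (Fin m) ℝ} {ν : Measure (Fin N → ℝ)}
  {Q : Channel M M'} {pol : AdmissiblePolicy N m M M'}
  {x w : ℕ → Ω → Fin N → ℝ} {u : ℕ → Ω → Fin m → ℝ} {q : ℕ → Ω → M} {q' : ℕ → Ω → M'}

lemma measurable_source (h : IsClosedLoop μ A B ν Q pol x w u q q') :
    Measurable fun ω => (x 0 ω, fun s : ℕ => w s ω) :=
  h.measurable_init.prodMk (measurable_pi_lambda _ h.measurable_noise)

lemma control_congr (h : IsClosedLoop μ A B ν Q pol x w u q q') {T : ℕ} {ω ω₀ : Ω}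
    (hω : hist q' T ω = hist q' T ω₀) {s : ℕ} (hs : s < T) : u s ω = u s ω₀ := by
  have hhist : hist q' (s + 1) ω = hist q' (s + 1) ω₀ :=
    congr_arg (Fin.take (s + 1) hs) hω
  rw [h.controller, h.controller, hhist]

lemma state_eq_pow_mulVec_add (h : IsClosedLoop μ A B ν Q pol x w u q q') {T : ℕ} {ω ω₀ : Ω}
    (hω : hist q' T ω = hist q' T ω₀) :
    x T ω = A ^ T *ᵥ x 0 ω + forcedResponse A (fun s => B *ᵥ u s ω₀ + w s ω) T := by
  rw [eq_pow_mulVec_add_forcedResponse (x := fun t => x t ω) (v := fun s => B *ᵥ u s ω + w s ω)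
    (fun t => by rw [h.dynamics, add_assoc]) T]
  congr 1
  exact forcedResponse_congr A fun s hs => by rw [h.control_congr hω hs]

section Measurability

variable [MeasurableSingletonClass M']

lemma measurable_state (h : IsClosedLoop μ A B ν Q pol x w u q q') (t : ℕ) :
    Measurable (x t) := by
  induction t with
  | zero => exact h.measurable_init
  | succ t ih =>
    have hu : Measurable (u t) := by
      rw [funext (h.controller t)]
      exact (measurable_of_countable (pol.ctrl t)).comp (measurable_hist h.measurable_output _)
    rw [funext (h.dynamics t)]
    exact (((measurable_mulVec A).comp ih).add ((measurable_mulVec B).comp hu)).add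
      (h.measurable_noise t)

lemma exists_isCompact_frequently (h : IsClosedLoop μ A B ν Q pol x w u q q')
    (hAMS : IsAMS (μ.map fun ω => fun t : ℕ => x t ω)) {ε : ℝ}
    (hε : 0 < ε) :
    ∃ K, IsCompact K ∧ ∃ᶠ T in atTop, 1 - ε < μ.real (x T ⁻¹' K) := by
  obtain ⟨K, hK, hfreq⟩ := hAMS.exists_isCompact_frequently hε
  refine ⟨K, hK, hfreq.mono fun T hT => ?_⟩
  have hpath : Measurable fun ω => fun t : ℕ => x t ω := measurable_pi_lambda _ h.measurable_state
  exact hT.trans_eq (map_measureReal_apply hpath (measurable_pi_apply T hK.measurableSet))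

lemma measurable_input (h : IsClosedLoop μ A B ν Q pol x w u q q') (t : ℕ) :
    Measurable (q t) := by
  rw [funext (h.encoder t)]
  exact (pol.measurable_enc t).comp
    ((measurable_hist h.measurable_state _).prodMk (measurable_hist h.measurable_output t))

end Measurability

section Channel

variable [MeasurableSingletonClass M] [MeasurableSingletonClass M'] [IsFiniteMeasure μ]

lemma isChannelProcess_restrict (h : IsClosedLoop μ A B ν Q pol x w u q q')
    {S : Set ((Fin N → ℝ) × (ℕ → Fin N → ℝ))} (hS : MeasurableSet S) :
    IsChannelProcess (μ.restrict ((fun ω => (x 0 ω, fun s : ℕ => w s ω)) ⁻¹' S)) Q q q' where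
  measurable_input := h.measurable_input
  measurable_output := h.measurable_output
  output_law t z c := by
    have hq := measurable_hist h.measurable_input (t + 1)
    have hq' := measurable_hist h.measurable_output t
    have hfibre : MeasurableSet (jointHist q q' (t + 1) t ⁻¹' {z}) :=
      hq.prodMk hq' (measurableSet_singleton z)
    have houtput : MeasurableSet (q' t ⁻¹' {c}) :=
      h.measurable_output t (measurableSet_singleton c)
    rw [measureReal_restrict_apply (houtput.inter hfibre), measureReal_restrict_apply hfibre,
      Set.inter_assoc]
    refine measureReal_inter_of_condExp (hq.prodMk (hq'.prodMk h.measurable_source)).comap_le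
      houtput ?_ ((h.classA_markov t c).trans (h.channel_law t c)) fun ω hω => ?_
    · refine ⟨{z.1} ×ˢ ({z.2} ×ˢ S), (measurableSet_singleton _).prod
        ((measurableSet_singleton _).prod hS), ?_⟩
      ext ω
      simp only [jointHist, Set.mem_preimage, Set.mem_prod, Set.mem_singleton_iff,
        Set.mem_inter_iff, Prod.ext_iff]
      tauto
    · obtain ⟨rfl, -⟩ := hω
      rfl

end Channel

section Converse

variable [Fintype M] [MeasurableSingletonClass M] [MeasurableSingletonClass M']
  [IsProbabilityMeasure μ]

lemma exists_measureReal_mul_logb_sub_le_directedInfo (h : IsClosedLoop μ A B ν Q pol x w u q q')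
    (hac : μ.map (x 0) ≪ volume) (hdet : A.det ≠ 0) (L T : ℕ) {K : Set (Fin N → ℝ)}
    (hK : MeasurableSet K) (hKfin : volume K ≠ ⊤) :
    ∃ P, μ.real ({ω | (μ.map (x 0)).rnDeriv volume (x 0 ω) ≤ L} ∩ x T ⁻¹' K) *
        (T * Real.logb 2 |A.det| - Real.logb 2 (L * volume.real K + 1)) - (Real.log 2)⁻¹ ≤
      directedInfo P Q T := by
  have hchannel : IsChannelProcess μ Q q q' := by
    simpa using h.isChannelProcess_restrict MeasurableSet.univ
  obtain ⟨P, hP⟩ := hchannel.exists_inputPolicy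
  -- The summand `1` keeps the bound on the probability positive when `K` is a null set.
  have hvol : 0 < L * volume.real K + 1 := by positivity
  have hlogb : T * Real.logb 2 |A.det| - Real.logb 2 (L * volume.real K + 1) =
      Real.logb 2 ((L * volume.real K + 1) / |A.det| ^ T)⁻¹ := by
    rw [inv_div, Real.logb_div (by positivity) hvol.ne', Real.logb_pow]
  have hG : MeasurableSet ({ω | (μ.map (x 0)).rnDeriv volume (x 0 ω) ≤ L} ∩ x T ⁻¹' K) :=
    (measurableSet_le ((Measure.measurable_rnDeriv _ _).comp h.measurable_init)
      measurable_const).inter (h.measurable_state T hK)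
  rw [hlogb]
  refine ⟨P, hchannel.measureReal_mul_logb_sub_le_directedInfo (hP T) hG
    (fun ω₀ => (fun ω => (x 0 ω, fun s : ℕ => w s ω)) ⁻¹'
      openLoopSources A (μ.map (x 0)) L (fun s => B *ᵥ u s ω₀) T K)
    (fun _ => h.isChannelProcess_restrict (measurableSet_openLoopSources _ _ _ hK))
    (fun ω₀ ω hω => ⟨hω.1.1, h.state_eq_pow_mulVec_add hω.2 ▸ hω.1.2⟩) (by positivity)
    fun ω₀ => ?_⟩
  refine (measureReal_preimage_openLoopSources_le h.measurable_init
    (measurable_pi_lambda _ h.measurable_noise) h.init_indep hac hdet L _ T hK hKfin).trans ?_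
  gcongr
  exact le_add_of_nonneg_right zero_le_one

lemma logb_abs_det_le_capacity (h : IsClosedLoop μ A B ν Q pol x w u q q') {C : ℝ}
    (hC : HasFeedbackCapacity Q C) (hac : μ.map (x 0) ≪ volume) (hdet : A.det ≠ 0)
    (htight : ∀ ε > 0, ∃ K, IsCompact K ∧ ∃ᶠ T in atTop, 1 - ε < μ.real (x T ⁻¹' K)) :
    Real.logb 2 |A.det| ≤ C := by
  set l := Real.logb 2 |A.det|
  have hdensity : ∀ᵐ ω ∂μ, (μ.map (x 0)).rnDeriv volume (x 0 ω) ≠ ⊤ :=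
    ae_of_ae_map h.measurable_init.aemeasurable (hac.ae_le (Measure.rnDeriv_ne_top _ _))
  have hle (ε : ℝ) (hε : 0 < ε) : l - ε * |l| ≤ C := by
    obtain ⟨K, hK, hKfreq⟩ := htight (ε / 2) (half_pos hε)
    obtain ⟨L, hfreq⟩ := exists_nat_frequently_lt_measureReal_inter
      ((Measure.measurable_rnDeriv (μ.map (x 0)) volume).comp h.measurable_init) hdensity
      (half_pos hε) hKfreq
    refine hC.le_of_frequently (b := |Real.logb 2 (L * volume.real K + 1)| + (Real.log 2)⁻¹)
      (hfreq.mono fun T hT => ?_)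
    obtain ⟨P, hP⟩ := h.exists_measureReal_mul_logb_sub_le_directedInfo hac hdet L T
      hK.measurableSet hK.measure_lt_top.ne
    have hg : 1 - ε ≤ μ.real ({ω | (μ.map (x 0)).rnDeriv volume (x 0 ω) ≤ L} ∩ x T ⁻¹' K) := by
      rw [sub_sub, add_halves] at hT
      exact hT.le
    have hsub := sub_mul_abs_sub_abs_le_mul_sub measureReal_nonneg measureReal_le_one hg (T * l)
      (Real.logb 2 (L * volume.real K + 1))
    rw [abs_mul, Nat.abs_cast] at hsub
    exact ⟨P, by linarith⟩
  have hlim : Tendsto (fun ε : ℝ => l - ε * |l|) (𝓝[>] 0) (𝓝 l) :=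
    tendsto_nhdsWithin_of_tendsto_nhds (Continuous.tendsto' (by fun_prop) _ _ (by simp))
  exact le_of_tendsto hlim (eventually_nhdsWithin_of_forall hle)

end Converse

end IsClosedLoop

theorem mainTheorem8_general
    {N m : ℕ} {M M' : Type*}
    [Fintype M] [MeasurableSpace M] [MeasurableSingletonClass M]
    [Fintype M'] [MeasurableSpace M'] [MeasurableSingletonClass M']
    {Ω : Type*} [MeasurableSpace Ω] {μ : Measure Ω} [IsProbabilityMeasure μ]
    {A : Matrix (Fin N) (Fin N) ℝ} {B : Matrix (Fin N) (Fin m) ℝ}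
    (hA : 0 ∉ A.charpoly.aroots ℂ) {ν : Measure (Fin N → ℝ)}
    {Q : Channel M M'} {C : ℝ} (hC : HasFeedbackCapacity Q C) {pol : AdmissiblePolicy N m M M'}
    {x w : ℕ → Ω → Fin N → ℝ} {u : ℕ → Ω → Fin m → ℝ} {q : ℕ → Ω → M} {q' : ℕ → Ω → M'}
    (hloop : IsClosedLoop μ A B ν Q pol x w u q q')
    (hac : μ.map (x 0) ≪ volume)
    (htight : ∀ ε > 0, ∃ K, IsCompact K ∧ ∃ᶠ T in atTop, 1 - ε < μ.real (x T ⁻¹' K)) :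
    ((A.charpoly.aroots ℂ).map (fun z => Real.logb 2 ‖z‖)).sum ≤ C := by
  have hdet : A.det ≠ 0 := by
    rw [← abs_ne_zero, ← norm_prod_aroots_charpoly, norm_ne_zero_iff]
    exact Multiset.prod_ne_zero hA
  rw [sum_map_logb_norm hA, norm_prod_aroots_charpoly]
  exact hloop.logb_abs_det_le_capacity hC hac hdet htight

theorem mainTheorem8
    {N m : ℕ} {M M' : Type*}
    [Fintype M] [MeasurableSpace M] [DiscreteMeasurableSpace M]
    [Fintype M'] [MeasurableSpace M'] [DiscreteMeasurableSpace M']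
    {Ω : Type*} [MeasurableSpace Ω] (μ : Measure Ω) [IsProbabilityMeasure μ]
    (A : Matrix (Fin N) (Fin N) ℝ) (B : Matrix (Fin N) (Fin m) ℝ)
    (hA : ∀ z ∈ A.charpoly.aroots ℂ, 1 ≤ ‖z‖)
    (ν : Measure (Fin N → ℝ))
    (Q : Channel M M') (C : ℝ) (hC : HasFeedbackCapacity Q C)
    (pol : AdmissiblePolicy N m M M')
    (x w : ℕ → Ω → Fin N → ℝ) (u : ℕ → Ω → Fin m → ℝ) (q : ℕ → Ω → M) (q' : ℕ → Ω → M')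
    (hloop : IsClosedLoop μ A B ν Q pol x w u q q')
    (hent : HasDiffEntropy (μ.map (x 0))) (hfin : diffEntropy (μ.map (x 0)) < ⊤)
    (hAMS : IsAMS (μ.map (fun ω => fun t : ℕ => x t ω))) :
    ((A.charpoly.aroots ℂ).map (fun z => Real.logb 2 ‖z‖)).sum ≤ C :=
  mainTheorem8_general (fun h0 => absurd (hA 0 h0) (by simp)) hC hloop hent.1 fun _ hε =>
    hloop.exists_isCompact_frequently hAMS hε
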